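/- Let $0<p\le 1$ and let $(A,\|\cdot\|)$ be a unital complex associative algebra with a uniform $p$-norm, that is, a map $\|\cdot\|:A\to[0,\infty)$ such that, for all $a,b\in A$ and $\alpha\in\mathbb{C}$: $\|a\|=0$ only if $a=0$, $\|a+b\|\le\|a\|+\|b\|$, $\|\alpha a\|=|\alpha|^{p}\|a\|$, $\|ab\|\le\|a\|\,\|b\|$ and $\|a^{2}\|=\|a\|^{2}$. Let $*$ be an involution on $A$ (a conjugate-linear map with $(a^{*})^{*}=a$ and $(ab)^{*}=b^{*}a^{*}$; no continuity is assumed). Let $B$ be the completion of $(A,\|\cdot\|)$, with its norm again denoted by $\|\cdot\|$, and suppose that for every $a\in A$ with $a^{*}=a$ the spectrum of $a$ in $B$ is contained in $\mathbb{R}$. Then $B$ is a commutative $C^{*}$-algebra: the multiplication of $B$ is commutative, the involution of $A$ extends to an involution of $B$, and with this extended involution and the norm $b\mapsto\|b\|^{1/p}$, $B$ is a $C^{*}$-algebra. -/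

import Mathlib

open UniformSpace

universe u

/-- A (complex, associative, unital) `p`-normed algebra, `0 < p ≤ 1`: the norm is a norm on the
additive group, is submultiplicative (both are part of `NormedRing`, which does not ask for
`‖1‖ = 1`), and is `p`-homogeneous. For `p < 1` this is not a `NormedAlgebra`. -/
class PNormedAlgebra (p : outParam ℝ) (A : Type*) [NormedRing A] [Algebra ℂ A] : Prop where
  p_pos : 0 < p
  p_le_one : p ≤ 1
  norm_smul_eq : ∀ (c : ℂ) (a : A), ‖c • a‖ = ‖c‖ ^ p * ‖a‖

/-- A uniform `p`-normed algebra: a `p`-normed algebra whose norm has the square property. -/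
class UniformPNormedAlgebra (p : outParam ℝ) (A : Type*) [NormedRing A] [Algebra ℂ A] : Prop
    extends PNormedAlgebra p A where
  norm_sq_eq : ∀ a : A, ‖a ^ 2‖ = ‖a‖ ^ 2

/-- Scalar multiplication by a fixed complex number is uniformly continuous on a `p`-normed
algebra. Through this fact the completion `Completion A`, already a complete normed ring for the
extended norm, becomes a complex algebra with scalar multiplication extended by continuity. -/
instance PNormedAlgebra.uniformContinuousConstSMul {p : ℝ} {A : Type*} [NormedRing A]
    [Algebra ℂ A] [h : PNormedAlgebra p A] : UniformContinuousConstSMul ℂ A where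
  uniformContinuous_const_smul c := by
    have hL : LipschitzWith (‖c‖₊ ^ p) (fun a : A => c • a) := by
      refine LipschitzWith.of_dist_le_mul fun x y => ?_
      rw [dist_eq_norm, dist_eq_norm, ← smul_sub, h.norm_smul_eq]
      simp
    exact hL.uniformContinuous

/-! Taking roots along powers of two, the square property turns estimates on powers into estimates
on elements, with constant or linear factors lost in the limit. In particular `‖ab‖ = ‖ba‖`, so the
entire function `z ↦ exp(za) b exp(-za)` is bounded by `‖b‖`. A Liouville theorem makes it constant,
and its first coefficient `ab - ba` vanishes. For `p < 1` duality and Cauchy integrals are not at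
hand; finite averages over roots of unity replace them (`norm_coeff_mul_le`,
`coeff_eq_zero_of_bounded`).

Once the completion is commutative, the binomial theorem shows that `‖·‖ ^ (1 / p)` is subadditive,
so the completion becomes a uniform Banach algebra and its Gelfand transform is isometric. Real
spectra make the transforms of self-adjoint elements of `A` real-valued; by density the closed image
is stable under conjugation, hence a C⋆-algebra. -/

open Filter Topology Finset in
/-- If `x ^ n ≤ C * (n + 1) * y ^ n` along the powers of two, then `x ≤ y`. -/
theorem le_of_forall_pow_two_pow_le {x y C : ℝ} (hy : 0 ≤ y)
    (h : ∀ k : ℕ, x ^ (2 ^ k) ≤ C * ((2 ^ k : ℕ) + 1) * y ^ (2 ^ k)) : x ≤ y := by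
  by_contra! hlt
  have hx : 0 < x := hy.trans_lt hlt
  rcases hy.eq_or_lt with rfl | hy
  · have := h 0
    simp at this
    linarith
  have hr : 1 < x / y := (one_lt_div hy).2 hlt
  have t := (tendsto_pow_const_div_const_pow_of_one_lt 1 hr).add
    (tendsto_pow_const_div_const_pow_of_one_lt 0 hr)
  have t2 := ((t.const_mul C).comp (tendsto_pow_atTop_atTop_of_one_lt (one_lt_two : 1 < 2)))
  simp only [add_zero, mul_zero] at t2
  obtain ⟨k, hk⟩ := (t2.eventually (gt_mem_nhds zero_lt_one)).exists
  have h' := h k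
  simp only [Function.comp_apply, pow_one, pow_zero, ← add_div, div_pow, ← mul_div_assoc] at hk
  rw [div_lt_one (by positivity), lt_div_iff₀ (by positivity)] at hk
  linarith

/-! ### Consequences of the square property -/

section Uniform

variable {R : Type*} [NormedRing R]

theorem norm_pow_two_pow_of_sq (h : ∀ a : R, ‖a ^ 2‖ = ‖a‖ ^ 2) (a : R) (k : ℕ) :
    ‖a ^ (2 ^ k)‖ = ‖a‖ ^ (2 ^ k) := by
  induction k with
  | zero => simp
  | succ k ih => rw [pow_succ, pow_mul, h, ih, ← pow_mul]

theorem norm_one_le_of_sq (h : ∀ a : R, ‖a ^ 2‖ = ‖a‖ ^ 2) : ‖(1 : R)‖ ≤ 1 := by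
  have := h 1
  rw [one_pow] at this
  nlinarith [norm_nonneg (1 : R)]

theorem norm_pow_le_of_sq (h : ∀ a : R, ‖a ^ 2‖ = ‖a‖ ^ 2) (a : R) (n : ℕ) :
    ‖a ^ n‖ ≤ ‖a‖ ^ n := by
  rcases n.eq_zero_or_pos with rfl | hn
  · simpa using norm_one_le_of_sq h
  · exact norm_pow_le' a hn

/-- Since `(ab)^(n+1) = a (ba)^n b`, large powers of `ab` and `ba` differ in norm by at most a
constant factor. -/
theorem norm_mul_le_norm_mul_comm_of_sq (h : ∀ a : R, ‖a ^ 2‖ = ‖a‖ ^ 2) (a b : R) :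
    ‖a * b‖ ≤ ‖b * a‖ := by
  have key (n : ℕ) : (a * b) ^ (n + 1) = a * (b * a) ^ n * b := by
    induction n with
    | zero => simp
    | succ n ih => rw [pow_succ, ih, pow_succ]; noncomm_ring
  rcases (norm_nonneg (b * a)).eq_or_lt with h0 | h0
  · have hba : b * a = 0 := norm_eq_zero.1 h0.symm
    have hsq := h (a * b)
    rw [key 1, pow_one, hba] at hsq
    simp only [mul_zero, zero_mul, norm_zero] at hsq
    rw [pow_eq_zero_iff two_ne_zero |>.1 hsq.symm]
    exact norm_nonneg _
  refine le_of_forall_pow_two_pow_le (C := ‖a‖ * ‖b‖ / ‖b * a‖) h0.le fun k => ?_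
  obtain ⟨n, hn⟩ : ∃ n, 2 ^ k = n + 1 := ⟨2 ^ k - 1, by have := Nat.one_le_two_pow (n := k); omega⟩
  rw [← norm_pow_two_pow_of_sq h, hn, key]
  calc ‖a * (b * a) ^ n * b‖ ≤ ‖a‖ * ‖b * a‖ ^ n * ‖b‖ :=
        (norm_mul_le _ _).trans (by
          gcongr
          exact (norm_mul_le _ _).trans (by gcongr; exact norm_pow_le_of_sq h _ _))
    _ = ‖a‖ * ‖b‖ / ‖b * a‖ * 1 * ‖b * a‖ ^ (n + 1) := by field_simp; ring
    _ ≤ _ := by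
      push_cast
      gcongr
      linarith [(n.cast_nonneg : (0 : ℝ) ≤ n)]

theorem norm_mul_comm_of_sq (h : ∀ a : R, ‖a ^ 2‖ = ‖a‖ ^ 2) (a b : R) :
    ‖a * b‖ = ‖b * a‖ :=
  le_antisymm (norm_mul_le_norm_mul_comm_of_sq h a b) (norm_mul_le_norm_mul_comm_of_sq h b a)

end Uniform

/-! ### Coefficient estimates for power series -/

section Analysis

open Filter Topology Finset Nat

theorem pow_div_factorial_rpow_le {p y : ℝ} (hp : 0 < p) (hy : 0 ≤ y) :
    ∃ C, 0 ≤ C ∧ ∀ n : ℕ, y ^ n / (n ! : ℝ) ^ p ≤ C * (1 / 2) ^ n := by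
  -- With `t ^ p = 2 * y`, the bound `t^n / n! ≤ exp t` raised to the power `p` leaves a spare
  -- `2^n`.
  set t : ℝ := (2 * y) ^ p⁻¹ with ht
  have ht0 : 0 ≤ t := by positivity
  have htp : t ^ p = 2 * y := Real.rpow_inv_rpow (by positivity) hp.ne'
  refine ⟨Real.exp t ^ p, by positivity, fun n => ?_⟩
  have h1 := Real.rpow_le_rpow (by positivity) (Real.pow_div_factorial_le_exp t ht0 n) hp.le
  rw [Real.div_rpow (by positivity) (by positivity), ← Real.rpow_natCast, ← Real.rpow_mul ht0,
    mul_comm (n : ℝ) p, Real.rpow_mul ht0, htp, Real.rpow_natCast, mul_pow] at h1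
  calc y ^ n / (n ! : ℝ) ^ p = (2 ^ n * y ^ n / (n ! : ℝ) ^ p) * (1 / 2) ^ n := by
        rw [one_div, inv_pow]; field_simp
    _ ≤ _ := by gcongr

theorem summable_pow_div_factorial_rpow {p y : ℝ} (hp : 0 < p) (hy : 0 ≤ y) :
    Summable fun n : ℕ => y ^ n / (n ! : ℝ) ^ p := by
  obtain ⟨C, -, hC⟩ := pow_div_factorial_rpow_le hp hy
  exact .of_nonneg_of_le (fun n => by positivity) hC (summable_geometric_two.mul_left C)

variable {p : ℝ} {R : Type*} [NormedRing R] [Algebra ℂ R] [hR : PNormedAlgebra p R]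

theorem norm_pow_smul (z : ℂ) (n : ℕ) (a : R) : ‖z ^ n • a‖ = (‖z‖ ^ p) ^ n * ‖a‖ := by
  rw [hR.norm_smul_eq, norm_pow, Real.rpow_pow_comm (norm_nonneg z)]

theorem norm_inv_factorial_smul (n : ℕ) (a : R) : ‖((n ! : ℂ)⁻¹) • a‖ = ‖a‖ / (n ! : ℝ) ^ p := by
  rw [hR.norm_smul_eq, norm_inv, Complex.norm_natCast, Real.inv_rpow (by positivity)]
  field_simp

/-- Coefficient extraction with roots of unity: the substitute for the Cauchy estimate. -/
theorem norm_coeff_mul_le [CompleteSpace R] {c : ℕ → R} {M r : ℝ} (hr : 0 ≤ r)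
    (hs : Summable fun n => (r ^ p) ^ n * ‖c n‖)
    (hM : ∀ z : ℂ, ‖z‖ = r → ‖∑' n, z ^ n • c n‖ ≤ M) {n N : ℕ} (hn : n < N) :
    (r ^ p) ^ n * ‖c n‖ ≤ (N : ℝ) ^ (1 - p) * M + ∑' m, (r ^ p) ^ (m + N) * ‖c (m + N)‖ := by
  have hN : N ≠ 0 := by omega
  have hN' : (0 : ℝ) < N := by positivity
  set ω : ℂ := Complex.exp (2 * Real.pi * Complex.I / N)
  have hω : IsPrimitiveRoot ω N := Complex.isPrimitiveRoot_exp N hN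
  have hω1 : ‖ω‖ = 1 := hω.norm'_eq_one hN
  have hp := hR.p_pos
  have hsz (z : ℂ) (hz : ‖z‖ = r) : Summable fun m => z ^ m • c m := by
    refine Summable.of_norm ?_
    simpa only [norm_pow_smul, hz] using hs
  have hz (k : ℕ) : ‖(r : ℂ) * ω ^ k‖ = r := by simp [hω1, abs_of_nonneg hr]
  -- The discrete Fourier weight: among indices below `N` it keeps only `n`. Indices from `N` on may
  -- alias, hence the tail in the bound.
  set g : ℕ → ℂ := fun m => ∑ k ∈ range N, (ω ^ (m + (N - n))) ^ k
  have hg1 (m : ℕ) : ‖g m‖ ≤ N := by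
    refine (norm_sum_le _ _).trans ?_
    simp [hω1]
  have hg0 {m : ℕ} (hm : m < N) (hmn : m ≠ n) : g m = 0 := by
    have h1 : ω ^ (m + (N - n)) ≠ 1 := by
      intro h
      have hd := hω.dvd_of_pow_eq_one _ h
      obtain ⟨t, ht⟩ := hd
      have : t < 2 := by by_contra! h2; have := Nat.mul_le_mul_left N h2; omega
      interval_cases t <;> omega
    have h2 := mul_geom_sum (ω ^ (m + (N - n))) N
    rw [← pow_mul, mul_comm _ N, pow_mul, hω.pow_eq_one, one_pow, sub_self] at h2
    exact (mul_eq_zero.1 h2).resolve_left (sub_ne_zero.2 h1)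
  have hgn : g n = N := by
    have : n + (N - n) = N := by omega
    simp [g, this, hω.pow_eq_one]
  set S : R := ∑ k ∈ range N, (ω ^ (N - n)) ^ k • ∑' m, ((r : ℂ) * ω ^ k) ^ m • c m
  have hsum : HasSum (fun m => (g m * (r : ℂ) ^ m) • c m) S := by
    have := hasSum_sum fun k (_ : k ∈ range N) =>
      (hsz _ (hz k)).hasSum.const_smul ((ω ^ (N - n)) ^ k)
    convert this using 2 with m
    simp only [g, smul_smul, ← Finset.sum_smul, Finset.sum_mul]
    congr 1
    refine Finset.sum_congr rfl fun k _ => ?_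
    ring
  have hS : ‖S‖ ≤ N * M := by
    refine (norm_sum_le _ _).trans ?_
    calc _ ≤ ∑ k ∈ range N, M := Finset.sum_le_sum fun k _ => by
          rw [← pow_mul, hR.norm_smul_eq, norm_pow, hω1, one_pow, Real.one_rpow, one_mul]
          exact hM _ (hz k)
      _ = N * M := by simp
  have hs' := (summable_nat_add_iff N).2 hs
  have hterm (m : ℕ) : ‖(g m * (r : ℂ) ^ m) • c m‖ ≤ (N : ℝ) ^ p * ((r ^ p) ^ m * ‖c m‖) := by
    rw [mul_smul, hR.norm_smul_eq, norm_pow_smul, Complex.norm_real, Real.norm_of_nonneg hr]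
    gcongr
    exact hg1 m
  have hT : ‖∑' m, (g (m + N) * (r : ℂ) ^ (m + N)) • c (m + N)‖
      ≤ (N : ℝ) ^ p * ∑' m, (r ^ p) ^ (m + N) * ‖c (m + N)‖ := by
    rw [← tsum_mul_left]
    exact tsum_of_norm_bounded (hs'.mul_left _).hasSum fun m => hterm _
  have hsplit := hsum.summable.sum_add_tsum_nat_add N
  rw [hsum.tsum_eq, Finset.sum_eq_single_of_mem n (Finset.mem_range.2 hn), hgn] at hsplit
  swap
  · intro m hm hmn
    rw [hg0 (Finset.mem_range.1 hm) hmn, zero_mul, zero_smul]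
  have hmain : ‖((N : ℂ) * (r : ℂ) ^ n) • c n‖ = (N : ℝ) ^ p * ((r ^ p) ^ n * ‖c n‖) := by
    rw [mul_smul, hR.norm_smul_eq, norm_pow_smul, Complex.norm_natCast, Complex.norm_real,
      Real.norm_of_nonneg hr]
  have hle : (N : ℝ) ^ p * ((r ^ p) ^ n * ‖c n‖)
      ≤ N * M + (N : ℝ) ^ p * ∑' m, (r ^ p) ^ (m + N) * ‖c (m + N)‖ := by
    rw [← hmain, eq_sub_of_add_eq hsplit]
    exact (norm_sub_le _ _).trans (add_le_add hS hT)
  refine le_of_mul_le_mul_left (hle.trans_eq ?_) (Real.rpow_pos_of_pos hN' p)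
  rw [mul_add, ← mul_assoc, ← Real.rpow_add hN', add_sub_cancel, Real.rpow_one]

end Analysis

/-! ### Liouville's theorem -/

section Liouville

open Filter Topology Finset Nat

variable {p : ℝ} {R : Type*} [NormedRing R] [Algebra ℂ R] [hR : PNormedAlgebra p R]

theorem inv_factorial_rpow_le {p : ℝ} (hp : 0 < p) {N m : ℕ} (hN : 0 < N) (hm : N ≤ m) :
    ((m ! : ℝ) ^ p)⁻¹ ≤ ((Real.exp 1 / N) ^ p) ^ m := by
  have hm0 : (0 : ℝ) < m := by exact_mod_cast hN.trans_le hm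
  have hN0 : (0 : ℝ) < N := by exact_mod_cast hN
  rw [← Real.inv_rpow (by positivity), Real.rpow_pow_comm (by positivity)]
  refine Real.rpow_le_rpow (by positivity) ?_ hp.le
  have h := Real.pow_div_factorial_le_exp (m : ℝ) hm0.le m
  rw [div_le_iff₀ (by positivity), ← Real.exp_one_pow] at h
  calc ((m ! : ℝ))⁻¹ ≤ (Real.exp 1 / m) ^ m := by
        rw [div_pow, inv_le_iff_one_le_mul₀ (by positivity), div_mul_eq_mul_div,
          one_le_div₀ (by positivity)]
        exact h
    _ ≤ _ := by gcongr

/-- A Liouville theorem: a bounded entire function with values in a complete `p`-normed algebra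
whose Taylor coefficients decay like those of an exponential is constant. -/
theorem coeff_eq_zero_of_bounded [CompleteSpace R] {c : ℕ → R} {C K M : ℝ} (hK : 0 ≤ K)
    (hc : ∀ m, ‖c m‖ ≤ C * (K ^ m / (m ! : ℝ) ^ p))
    (hM : ∀ z : ℂ, ‖∑' n, z ^ n • c n‖ ≤ M) {n : ℕ} (hn : n ≠ 0) : c n = 0 := by
  have hp := hR.p_pos
  have hC : 0 ≤ C := by
    have := (norm_nonneg _).trans (hc 0)
    simpa using this
  have hpn {n : ℕ} (hn : n ≠ 0) : 0 < p * n := by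
    have : 0 < n := by omega
    positivity
  have hterm (r : ℝ) (m : ℕ) : (r ^ p) ^ m * ‖c m‖ ≤ |(r ^ p) ^ m| * (C * (K ^ m / (m ! : ℝ) ^ p)) :=
    mul_le_mul (le_abs_self _) (hc m) (norm_nonneg _) (abs_nonneg _)
  have hs (r : ℝ) (hr : 0 ≤ r) : Summable fun m => (r ^ p) ^ m * ‖c m‖ := by
    refine .of_nonneg_of_le (fun m => by positivity) (hterm r)
      (((summable_pow_div_factorial_rpow hp
        (show 0 ≤ r ^ p * K by positivity)).mul_left C).congr fun m => ?_)
    rw [abs_of_nonneg (by positivity), mul_pow]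
    ring
  -- At radius `ε * N`, this choice dominates the terms of index at least `N` by a geometric series
  -- of ratio 1/2, uniformly in `N`.
  obtain ⟨ε, hε, hεK⟩ : ∃ ε : ℝ, 0 < ε ∧ K * (ε * Real.exp 1) ^ p ≤ 1 / 2 := by
    refine ⟨(1 / (2 * (K + 1))) ^ p⁻¹ * Real.exp (-1), by positivity, ?_⟩
    rw [mul_assoc, ← Real.exp_add, neg_add_cancel, Real.exp_zero, mul_one,
      Real.rpow_inv_rpow (by positivity) hp.ne', mul_one_div, div_le_div_iff₀ (by positivity)
      two_pos]
    linarith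
  have htail (N : ℕ) (hN : 0 < N) :
      ∑' m, ((ε * N) ^ p) ^ (m + N) * ‖c (m + N)‖ ≤ C * 2 := by
    rw [← tsum_geometric_two, ← tsum_mul_left]
    refine ((summable_nat_add_iff N).2 (hs (ε * N) (by positivity))).tsum_le_tsum (fun m => ?_)
      (summable_geometric_two.mul_left C)
    have hN0 : (0 : ℝ) < N := by positivity
    calc _ ≤ ((ε * N) ^ p) ^ (m + N) * (C * (K ^ (m + N) * ((Real.exp 1 / N) ^ p) ^ (m + N))) := by
          refine mul_le_mul_of_nonneg_left ((hc _).trans ?_) (by positivity)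
          rw [div_eq_mul_inv]
          gcongr
          exact inv_factorial_rpow_le hp hN (by omega)
      _ = C * (K * (ε * Real.exp 1) ^ p) ^ (m + N) := by
          have : ε * Real.exp 1 = (ε * N) * (Real.exp 1 / N) := by field_simp
          rw [this, Real.mul_rpow (x := ε * N) (by positivity) (by positivity), mul_pow, mul_pow]
          ring
      _ ≤ C * (1 / 2) ^ (m + N) := by gcongr
      _ ≤ C * (1 / 2) ^ m := by
          gcongr ?_ * ?_
          exact pow_le_pow_of_le_one (by norm_num) (by norm_num) (by omega)
  -- The radius grows with the number of roots of unity: the gain `N^(p n)` beats the loss `N^(1 -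
  -- p)` exactly when `1 - p < p * n`.
  have hlarge (n : ℕ) (hn : n ≠ 0) (hn' : 1 - p < p * n) : c n = 0 := by
    have hbound : ∀ᶠ N : ℕ in atTop, (ε ^ p) ^ n * ‖c n‖
        ≤ M * (N : ℝ) ^ (-(p * n - (1 - p))) + C * 2 * (N : ℝ) ^ (-(p * n)) := by
      filter_upwards [eventually_gt_atTop n] with N hN
      have hN0 : (0 : ℝ) < N := by exact_mod_cast (Nat.zero_le n).trans_lt hN
      have h := (norm_coeff_mul_le (r := ε * N) (by positivity) (hs _ (by positivity))
        (fun z _ => hM z) hN).trans (add_le_add_right (htail N (by omega)) _)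
      have hpos : 0 < (N : ℝ) ^ (p * n) := by positivity
      refine le_of_mul_le_mul_left ?_ hpos
      calc (N : ℝ) ^ (p * n) * ((ε ^ p) ^ n * ‖c n‖) = ((ε * N) ^ p) ^ n * ‖c n‖ := by
            rw [Real.mul_rpow hε.le hN0.le, mul_pow, Real.rpow_mul hN0.le, Real.rpow_natCast]
            ring
        _ ≤ _ := h
        _ = (N : ℝ) ^ (p * n) * (M * (N : ℝ) ^ (-(p * n - (1 - p))))
            + C * 2 * ((N : ℝ) ^ (p * n) * (N : ℝ) ^ (-(p * n))) := by
            rw [← Real.rpow_add hN0, add_neg_cancel, Real.rpow_zero, mul_left_comm,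
              ← Real.rpow_add hN0]
            ring_nf
        _ = _ := by ring
    have hlim := (((tendsto_rpow_neg_atTop (y := p * n - (1 - p)) (by linarith)).comp
      tendsto_natCast_atTop_atTop).const_mul M).add
      (((tendsto_rpow_neg_atTop (hpn hn)).comp tendsto_natCast_atTop_atTop).const_mul (C * 2))
    have h0 := ge_of_tendsto hlim hbound
    simp only [mul_zero, add_zero] at h0
    have : 0 < (ε ^ p) ^ n := by positivity
    exact norm_le_zero_iff.1 (nonpos_of_mul_nonpos_right h0 this)
  -- The series is now a polynomial. With `N` fixed beyond its degree the tail is zero, and `r → ∞`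
  -- kills the low coefficients.
  obtain ⟨n₀, hn₀⟩ := exists_nat_gt ((1 - p) / p)
  rw [div_lt_iff₀' hp] at hn₀
  set N := max (n₀ + 1) (n + 1)
  have hzero (m : ℕ) : c (m + N) = 0 := by
    refine hlarge _ (by omega) (hn₀.trans_le ?_)
    gcongr
    omega
  by_contra hcn
  have hlim : Tendsto (fun r : ℝ => (r ^ p) ^ n * ‖c n‖) atTop atTop :=
    ((tendsto_pow_atTop hn).comp (tendsto_rpow_atTop hp)).atTop_mul_const (norm_pos_iff.2 hcn)
  obtain ⟨r, hr, hr0⟩ := ((hlim.eventually_gt_atTop ((N : ℝ) ^ (1 - p) * M)).and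
    (eventually_ge_atTop 0)).exists
  have h := norm_coeff_mul_le hr0 (hs r hr0) (fun z _ => hM z) (show n < N by omega)
  simp only [hzero, norm_zero, mul_zero, tsum_zero, add_zero] at h
  exact absurd h (not_le.2 hr)

end Liouville

/-! ### Commutativity through exponentials -/

section Commutativity

open Finset Nat

variable {p : ℝ} {R : Type*} [NormedRing R] [Algebra ℂ R]

/-- The `n`-th term of the exponential series of `z • a`. -/
noncomputable def expTerm (a : R) (z : ℂ) (n : ℕ) : R := z ^ n • ((n ! : ℂ)⁻¹ • a ^ n)

/-- The Taylor coefficients of `z ↦ exp (z • a) * b * exp (-z • a)`. -/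
noncomputable def conjCoeff (a b : R) (n : ℕ) : R :=
  ∑ ij ∈ antidiagonal n, ((ij.1 ! : ℂ)⁻¹ • a ^ ij.1) * b * ((ij.2 ! : ℂ)⁻¹ • (-a) ^ ij.2)

theorem conjCoeff_one_left (a b : R) : conjCoeff a b 1 = a * b - b * a := by
  simp [conjCoeff, Finset.Nat.antidiagonal_succ]
  abel

/-- Coefficient form of `exp(za) exp(-za) = 1`: up to `1 / n!` this is the binomial expansion of `(a
- a)^n`. -/
theorem conjCoeff_one (a : R) (n : ℕ) : conjCoeff a 1 n = if n = 0 then 1 else 0 := by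
  have h := ((Commute.refl a).neg_right).add_pow' n
  rw [add_neg_cancel] at h
  have : conjCoeff a 1 n = (n ! : ℂ)⁻¹ • (0 : R) ^ n := by
    rw [h, conjCoeff, Finset.smul_sum]
    refine Finset.sum_congr rfl fun ij hij => ?_
    rw [HasAntidiagonal.mem_antidiagonal] at hij
    rw [mul_one, smul_mul_smul_comm, ← Nat.cast_smul_eq_nsmul ℂ, smul_smul, ← hij]
    congr 1
    have := Nat.add_choose_mul_factorial_mul_factorial ij.1 ij.2
    rw [← this, Nat.choose_symm_add]
    push_cast
    have h3 : ((ij.1 + ij.2).choose ij.2 : ℂ) ≠ 0 := by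
      exact_mod_cast (Nat.choose_pos (Nat.le_add_left _ _)).ne'
    have h1 : ((ij.1 ! : ℕ) : ℂ) ≠ 0 := by exact_mod_cast ij.1.factorial_ne_zero
    have h2 : ((ij.2 ! : ℕ) : ℂ) ≠ 0 := by exact_mod_cast ij.2.factorial_ne_zero
    field_simp
  rw [this]
  split_ifs with hn
  · simp [hn]
  · simp [hn]

theorem summable_norm_expTerm [hR : UniformPNormedAlgebra p R]
    (a : R) (z : ℂ) : Summable fun n => ‖expTerm a z n‖ := by
  have hp := hR.p_pos
  refine .of_nonneg_of_le (fun _ => norm_nonneg _) (fun n => ?_)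
    (summable_pow_div_factorial_rpow hp (y := ‖z‖ ^ p * ‖a‖) (by positivity))
  rw [expTerm, norm_pow_smul, norm_inv_factorial_smul, mul_pow, mul_div_assoc]
  gcongr
  exact norm_pow_le_of_sq hR.norm_sq_eq a n

/-- The 4 is 2 · 2: one factor from `choose ^ p ≤ 2^n`, one from the `n + 1 ≤ 2^n` summands. -/
theorem norm_conjCoeff_le [hR : UniformPNormedAlgebra p R]
    (a b : R) (n : ℕ) :
    ‖conjCoeff a b n‖ ≤ ‖b‖ * ((4 * ‖a‖) ^ n / (n ! : ℝ) ^ p) := by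
  have hp := hR.p_pos
  calc ‖conjCoeff a b n‖
      ≤ ∑ ij ∈ antidiagonal n, ‖b‖ * (2 ^ n * ‖a‖ ^ n / (n ! : ℝ) ^ p) := by
        refine (norm_sum_le _ _).trans (Finset.sum_le_sum fun ij hij => ?_)
        rw [HasAntidiagonal.mem_antidiagonal] at hij
        have hfac : (n ! : ℝ) ^ p ≤ 2 ^ n * ((ij.1 ! : ℝ) ^ p * (ij.2 ! : ℝ) ^ p) := by
          have h1 := Nat.add_choose_mul_factorial_mul_factorial ij.1 ij.2
          rw [hij] at h1
          rw [← h1]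
          push_cast
          rw [mul_assoc, Real.mul_rpow (by positivity) (by positivity),
            Real.mul_rpow (by positivity) (by positivity)]
          gcongr
          calc ((n.choose ij.2 : ℕ) : ℝ) ^ p ≤ ((2 : ℝ) ^ n) ^ p := by
                gcongr
                exact_mod_cast Nat.choose_le_two_pow n ij.2
            _ ≤ ((2 : ℝ) ^ n) ^ (1 : ℝ) :=
                Real.rpow_le_rpow_of_exponent_le (one_le_pow₀ one_le_two) hR.p_le_one
            _ = 2 ^ n := Real.rpow_one _
        calc _ ≤ (‖a‖ ^ ij.1 / (ij.1 ! : ℝ) ^ p) * ‖b‖ * (‖a‖ ^ ij.2 / (ij.2 ! : ℝ) ^ p) := by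
              refine (norm_mul_le _ _).trans ?_
              rw [norm_inv_factorial_smul]
              gcongr
              · refine (norm_mul_le _ _).trans ?_
                rw [norm_inv_factorial_smul]
                gcongr
                exact norm_pow_le_of_sq hR.norm_sq_eq a _
              · simpa using norm_pow_le_of_sq hR.norm_sq_eq (-a) ij.2
          _ = ‖b‖ * (‖a‖ ^ n / ((ij.1 ! : ℝ) ^ p * (ij.2 ! : ℝ) ^ p)) := by
              rw [← hij, pow_add]; ring
          _ ≤ _ := by
              gcongr ‖b‖ * ?_
              rw [div_le_div_iff₀ (by positivity) (by positivity)]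
              calc _ ≤ ‖a‖ ^ n * (2 ^ n * ((ij.1 ! : ℝ) ^ p * (ij.2 ! : ℝ) ^ p)) := by gcongr
                _ = _ := by ring
    _ = (n + 1) * (‖b‖ * (2 ^ n * ‖a‖ ^ n / (n ! : ℝ) ^ p)) := by simp
    _ ≤ 2 ^ n * (‖b‖ * (2 ^ n * ‖a‖ ^ n / (n ! : ℝ) ^ p)) := by
        gcongr
        exact_mod_cast Nat.lt_two_pow_self
    _ = _ := by
        rw [show (4 : ℝ) = 2 * 2 by norm_num, mul_pow, mul_pow]; ring

theorem tsum_expTerm_mul_mul_tsum_expTerm [hR : UniformPNormedAlgebra p R] [CompleteSpace R]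
    (a b : R) (z : ℂ) :
    (∑' n, expTerm a z n) * b * (∑' n, expTerm (-a) z n) = ∑' n, z ^ n • conjCoeff a b n := by
  have hs := summable_norm_expTerm a z
  have hsb : Summable fun n => ‖expTerm a z n * b‖ :=
    .of_nonneg_of_le (fun _ => norm_nonneg _) (fun n => norm_mul_le _ _) (hs.mul_right ‖b‖)
  rw [← hs.of_norm.tsum_mul_right,
    tsum_mul_tsum_eq_tsum_sum_antidiagonal_of_summable_norm hsb (summable_norm_expTerm (-a) z)]
  refine tsum_congr fun n => ?_
  rw [conjCoeff, Finset.smul_sum]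
  refine Finset.sum_congr rfl fun ij hij => ?_
  rw [HasAntidiagonal.mem_antidiagonal] at hij
  rw [expTerm, expTerm, smul_mul_assoc, smul_mul_smul_comm, ← pow_add, hij]

theorem tsum_expTerm_mul_tsum_expTerm_neg [hR : UniformPNormedAlgebra p R] [CompleteSpace R]
    (a : R) (z : ℂ) :
    (∑' n, expTerm a z n) * (∑' n, expTerm (-a) z n) = 1 := by
  have h := tsum_expTerm_mul_mul_tsum_expTerm a 1 z
  rw [mul_one] at h
  rw [h, tsum_eq_single 0 fun n hn => by simp [conjCoeff_one, hn]]
  simp [conjCoeff_one]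

/-- A complete uniform `p`-normed algebra is commutative. -/
theorem mul_comm_of_uniformPNormedAlgebra [hR : UniformPNormedAlgebra p R] [CompleteSpace R]
    (a b : R) : a * b = b * a := by
  have h1 : conjCoeff a b 1 = 0 := by
    refine coeff_eq_zero_of_bounded (by positivity) (norm_conjCoeff_le a b) (M := ‖b‖)
      (fun z => ?_) one_ne_zero
    -- Cyclicity of the norm moves `exp(za)` to the right, where it cancels `exp(-za)`.
    rw [← tsum_expTerm_mul_mul_tsum_expTerm, mul_assoc, norm_mul_comm_of_sq hR.norm_sq_eq,
      mul_assoc]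
    have := tsum_expTerm_mul_tsum_expTerm_neg (-a) z
    rw [neg_neg] at this
    rw [this, mul_one]
  rwa [conjCoeff_one_left, sub_eq_zero] at h1

end Commutativity

/-! ### Triangle inequality for the `p`-th root -/

section Subadditive

open Finset

variable {p : ℝ} {R : Type*} [NormedRing R] [Algebra ℂ R]

/-- Each of the `n + 1` binomial terms of `(a + b)^n` has norm at most the `p`-th power of a term of
`(α + β)^n`. -/
theorem norm_add_le_rpow_of_commute [hR : UniformPNormedAlgebra p R] {a b : R}
    (hab : Commute a b) : ‖a + b‖ ≤ (‖a‖ ^ (1 / p) + ‖b‖ ^ (1 / p)) ^ p := by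
  have hp := hR.p_pos
  have hroot (x : R) : (‖x‖ ^ (1 / p)) ^ p = ‖x‖ := by
    rw [one_div, Real.rpow_inv_rpow (norm_nonneg x) hp.ne']
  set α := ‖a‖ ^ (1 / p)
  set β := ‖b‖ ^ (1 / p)
  have hα : 0 ≤ α := by positivity
  have hβ : 0 ≤ β := by positivity
  refine le_of_forall_pow_two_pow_le (C := 1) (by positivity) fun k => ?_
  rw [← norm_pow_two_pow_of_sq hR.norm_sq_eq]
  generalize 2 ^ k = n
  rw [hab.add_pow']
  calc _ ≤ ∑ ij ∈ antidiagonal n, ((α + β) ^ p) ^ n := by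
        refine (norm_sum_le _ _).trans (Finset.sum_le_sum fun ij hij => ?_)
        rw [← Nat.cast_smul_eq_nsmul ℂ, hR.norm_smul_eq, Complex.norm_natCast]
        calc _ ≤ (n.choose ij.1 : ℝ) ^ p * ((α ^ p) ^ ij.1 * (β ^ p) ^ ij.2) := by
              rw [hroot, hroot]
              gcongr
              exact (norm_mul_le _ _).trans (mul_le_mul (norm_pow_le_of_sq hR.norm_sq_eq a _)
                (norm_pow_le_of_sq hR.norm_sq_eq b _) (norm_nonneg _) (by positivity))
          _ = (n.choose ij.1 * (α ^ ij.1 * β ^ ij.2)) ^ p := by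
              rw [Real.rpow_pow_comm hα, Real.rpow_pow_comm hβ,
                ← Real.mul_rpow (by positivity) (by positivity),
                ← Real.mul_rpow (by positivity) (by positivity)]
          _ ≤ ((α + β) ^ n) ^ p := by
              gcongr
              rw [(Commute.all α β).add_pow', ← nsmul_eq_mul]
              exact Finset.single_le_sum
                (f := fun m : ℕ × ℕ => n.choose m.1 • (α ^ m.1 * β ^ m.2))
                (fun m _ => by positivity) hij
          _ = _ := (Real.rpow_pow_comm (by positivity) _ _).symm
    _ = _ := by simp

end Subadditive

/-! ### The associated Banach algebra -/

section Renorming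

/-- A complete uniform `p`-normed algebra, to be equipped with the norm `b ↦ ‖b‖ ^ (1 / p)`. -/
def Renormed (_ : ℝ) (R : Type*) : Type _ := R

namespace Renormed

variable {p : ℝ} {R : Type*} [NormedRing R] [Algebra ℂ R]

instance : Ring (Renormed p R) := inferInstanceAs (Ring R)

instance : Algebra ℂ (Renormed p R) := inferInstanceAs (Algebra ℂ R)

variable (p R) in
/-- The identity map onto the renormed algebra. -/
def equiv : R ≃ₐ[ℂ] Renormed p R := AlgEquiv.refl

noncomputable instance : Norm (Renormed p R) := ⟨fun b => ‖(equiv p R).symm b‖ ^ (1 / p)⟩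

theorem norm_equiv (b : R) : ‖equiv p R b‖ = ‖b‖ ^ (1 / p) := rfl

theorem norm_def (b : Renormed p R) : ‖b‖ = ‖(equiv p R).symm b‖ ^ (1 / p) := rfl

variable [hR : UniformPNormedAlgebra p R] [CompleteSpace R]

noncomputable instance : NormedRing (Renormed p R) :=
  RingNorm.toNormedRing
    { toFun := fun b => ‖b‖
      map_zero' := by
        have := hR.p_pos
        rw [norm_def, map_zero, norm_zero, Real.zero_rpow (by positivity)]
      add_le' := fun x y => by
        have hp := hR.p_pos
        rw [norm_def, map_add, one_div]
        refine (Real.rpow_inv_le_iff_of_pos (norm_nonneg _) ?_ hp).2 ?_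
        · rw [norm_def, norm_def]
          positivity
        · exact norm_add_le_rpow_of_commute (mul_comm_of_uniformPNormedAlgebra _ _)
      neg' := fun x => by rw [norm_def, map_neg, norm_neg, norm_def]
      mul_le' := fun x y => by
        have hp := hR.p_pos
        rw [norm_def, norm_def, norm_def, ← Real.mul_rpow (norm_nonneg _) (norm_nonneg _), map_mul]
        gcongr
        exact norm_mul_le _ _
      eq_zero_of_map_eq_zero' := fun x hx => by
        have hp := hR.p_pos
        rw [norm_def, Real.rpow_eq_zero (norm_nonneg _) (by positivity), norm_eq_zero] at hx
        exact (map_eq_zero_iff _ (equiv p R).symm.injective).1 hx }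

noncomputable instance : NormedCommRing (Renormed p R) where
  mul_comm := mul_comm_of_uniformPNormedAlgebra (R := R)

noncomputable instance : NormedAlgebra ℂ (Renormed p R) where
  norm_smul_le z x := by
    have hp := hR.p_pos
    rw [norm_def, norm_def, map_smul, hR.norm_smul_eq,
      Real.mul_rpow (by positivity) (norm_nonneg _), one_div,
      Real.rpow_rpow_inv (norm_nonneg _) hp.ne']

theorem norm_sq (x : Renormed p R) : ‖x ^ 2‖ = ‖x‖ ^ 2 := by
  rw [norm_def, map_pow, hR.norm_sq_eq, norm_def, Real.rpow_pow_comm (norm_nonneg _)]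

theorem continuous_equiv : Continuous (equiv p R) := by
  have hp := hR.p_pos
  refine continuous_of_continuousAt_zero (equiv p R) ?_
  rw [ContinuousAt, map_zero, tendsto_zero_iff_norm_tendsto_zero]
  simp only [norm_equiv]
  have h : Continuous fun b : R => ‖b‖ ^ (1 / p) :=
    continuous_norm.rpow_const fun _ => Or.inr (by positivity)
  simpa [Real.zero_rpow hp.ne', Real.zero_rpow (inv_pos.2 hp).ne'] using h.tendsto 0

instance : CompleteSpace (Renormed p R) := by
  have hp := hR.p_pos
  refine Metric.complete_of_cauchySeq_tendsto fun s hs => ?_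
  have hc : CauchySeq fun n => (equiv p R).symm (s n) := by
    rw [Metric.cauchySeq_iff] at hs ⊢
    intro ε hε
    obtain ⟨N, hN⟩ := hs (ε ^ (1 / p)) (by positivity)
    refine ⟨N, fun m hm n hn => ?_⟩
    have h := hN m hm n hn
    rw [dist_eq_norm] at h ⊢
    rw [← map_sub]
    exact (Real.rpow_lt_rpow_iff (norm_nonneg _) hε.le (by positivity : 0 < 1 / p)).1 h
  obtain ⟨b, hb⟩ := cauchySeq_tendsto_of_complete hc
  exact ⟨equiv p R b, (continuous_equiv.tendsto b).comp hb⟩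

end Renormed

end Renorming

/-! ### Gelfand representation -/

section Gelfand

open Filter Topology WeakDual ComplexStarModule

theorem spectralRadius_eq_nnnorm_of_sq {R : Type*} [NormedRing R] [NormedAlgebra ℂ R]
    [CompleteSpace R] (h : ∀ a : R, ‖a ^ 2‖ = ‖a‖ ^ 2) (a : R) : spectralRadius ℂ a = ‖a‖₊ := by
  have hconst : Tendsto (fun _ : ℕ => (‖a‖₊ : ENNReal)) atTop (𝓝 ‖a‖₊) := tendsto_const_nhds
  refine tendsto_nhds_unique ?_ hconst
  convert! (spectrum.pow_nnnorm_pow_one_div_tendsto_nhds_spectralRadius a).comp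
    (tendsto_pow_atTop_atTop_of_one_lt one_lt_two) using 1
  refine funext fun n => ?_
  have hn : ‖a ^ 2 ^ n‖₊ = ‖a‖₊ ^ 2 ^ n := NNReal.eq (norm_pow_two_pow_of_sq h a n)
  rw [Function.comp_apply, hn, ENNReal.coe_pow, ← ENNReal.rpow_natCast, ← ENNReal.rpow_mul]
  simp

variable {C : Type u} [NormedCommRing C] [NormedAlgebra ℂ C] [CompleteSpace C]

theorem norm_gelfandTransform_of_sq (h : ∀ x : C, ‖x ^ 2‖ = ‖x‖ ^ 2) (x : C) :
    ‖gelfandTransform ℂ C x‖ = ‖x‖ := by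
  have h1 := IsStarNormal.spectralRadius_eq_nnnorm (gelfandTransform ℂ C x)
  rw [spectralRadius, spectrum.gelfandTransform_eq, ← spectralRadius,
    spectralRadius_eq_nnnorm_of_sq h, ENNReal.coe_inj] at h1
  exact congrArg NNReal.toReal h1.symm

theorem gelfandTransform_map_star_of_spectrum_real {A : Type*} [Ring A] [Algebra ℂ A] [StarRing A]
    [StarModule ℂ A] (f : A →ₐ[ℂ] C)
    (hreal : ∀ a : A, IsSelfAdjoint a → ∀ z ∈ spectrum ℂ (f a), z.im = 0) (a : A) :
    gelfandTransform ℂ C (f (star a)) = star (gelfandTransform ℂ C (f a)) := by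
  have hsa {a : A} (ha : IsSelfAdjoint a) :
      star (gelfandTransform ℂ C (f a)) = gelfandTransform ℂ C (f a) := by
    ext φ
    exact Complex.conj_eq_iff_im.2
      (hreal a ha _ (CharacterSpace.mem_spectrum_iff_exists.2 ⟨φ, rfl⟩))
  have h1 := hsa (ℜ a).2
  have h2 := hsa (ℑ a).2
  conv_lhs => rw [← realPart_add_I_smul_imaginaryPart a]
  conv_rhs => rw [← realPart_add_I_smul_imaginaryPart a]
  rw [star_add, star_smul, (ℜ a).2.star_eq, (ℑ a).2.star_eq]
  simp only [map_add, map_smul, star_add, star_smul, h1, h2]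

/-- A uniform commutative Banach algebra containing a dense image of a star algebra whose
self-adjoint elements have real spectrum is a `C⋆`-algebra. -/
theorem exists_commCStarAlgebra_of_denseRange {A : Type*} [Ring A] [Algebra ℂ A] [StarRing A]
    [StarModule ℂ A] (h : ∀ x : C, ‖x ^ 2‖ = ‖x‖ ^ 2) (f : A →ₐ[ℂ] C) (hf : DenseRange f)
    (hreal : ∀ a : A, IsSelfAdjoint a → ∀ z ∈ spectrum ℂ (f a), z.im = 0) :
    ∃ (D : Type u) (_ : CommCStarAlgebra D) (e : C ≃ₐ[ℂ] D),
      (∀ x, ‖e x‖ = ‖x‖) ∧ ∀ a, e (f (star a)) = star (e (f a)) := by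
  set G := gelfandTransform ℂ C
  have hG : Isometry G := AddMonoidHomClass.isometry_of_norm G (norm_gelfandTransform_of_sq h)
  have hclosed : IsClosed (Set.range G) := hG.isClosedEmbedding.isClosed_range
  -- The range is closed, so stability under conjugation need only be checked on the dense image of
  -- `A`.
  have hstar (x : C) : star (G x) ∈ Set.range G :=
    hf.induction_on x (hclosed.preimage (continuous_star.comp hG.continuous))
      fun a => ⟨f (star a), gelfandTransform_map_star_of_spectrum_real f hreal a⟩
  let S : StarSubalgebra ℂ C(characterSpace ℂ C, ℂ) :=
    { G.range with
      star_mem' := by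
        rintro _ ⟨x, rfl⟩
        exact hstar x }
  have hS : IsClosed (S : Set C(characterSpace ℂ C, ℂ)) := hclosed
  exact ⟨S, StarSubalgebra.commCStarAlgebra S, AlgEquiv.ofInjective G hG.injective,
    norm_gelfandTransform_of_sq h,
    fun a => Subtype.ext (gelfandTransform_map_star_of_spectrum_real f hreal a)⟩

end Gelfand

/-! ### Passage to the completion -/

section Completion

variable {p : ℝ} {A : Type u} [NormedRing A] [Algebra ℂ A]

instance UniformPNormedAlgebra.completion [hA : UniformPNormedAlgebra p A] :
    UniformPNormedAlgebra p (Completion A) where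
  p_pos := hA.p_pos
  p_le_one := hA.p_le_one
  norm_smul_eq c b := by
    induction b using Completion.induction_on with
    | hp =>
      exact isClosed_eq (continuous_const_smul c).norm (continuous_const.mul continuous_norm)
    | ih a => rw [← Completion.coe_smul, Completion.norm_coe, Completion.norm_coe, hA.norm_smul_eq]
  norm_sq_eq b := by
    induction b using Completion.induction_on with
    | hp => exact isClosed_eq (continuous_pow 2).norm (continuous_norm.pow 2)
    | ih a =>
      rw [sq (a : Completion A), ← Completion.coe_mul, Completion.norm_coe, Completion.norm_coe,
        ← sq, hA.norm_sq_eq]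

variable (A) in
/-- The canonical map to the completion, as an algebra homomorphism. -/
noncomputable def completionCoeAlgHom [PNormedAlgebra p A] : A →ₐ[ℂ] Completion A :=
  { (Completion.coeRingHom : A →+* Completion A) with commutes' := fun _ => rfl }

end Completion

theorem corollary4p6 {p : ℝ} {A : Type u} [NormedRing A] [Algebra ℂ A]
    [UniformPNormedAlgebra p A] [StarRing A] [StarModule ℂ A]
    (hreal : ∀ a : A, IsSelfAdjoint a →
      ∀ z ∈ spectrum ℂ ((a : A) : Completion A), z.im = 0) :
    ∃ (C : Type u) (_ : CommCStarAlgebra C) (e : Completion A ≃ₐ[ℂ] C),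
      (∀ b : Completion A, ‖e b‖ = ‖b‖ ^ (1 / p)) ∧
      (∀ a : A, e ((star a : A) : Completion A) = star (e ((a : A) : Completion A))) := by
  let ι := Renormed.equiv p (Completion A)
  let f : A →ₐ[ℂ] Renormed p (Completion A) := (ι : _ →ₐ[ℂ] _).comp (completionCoeAlgHom A)
  have hf : DenseRange f :=
    ι.surjective.denseRange.comp Completion.denseRange_coe Renormed.continuous_equiv
  obtain ⟨D, _, e, he, hstar⟩ := exists_commCStarAlgebra_of_denseRange Renormed.norm_sq f hf
    fun a ha z hz => hreal a ha z (by rwa [← AlgEquiv.spectrum_eq ι])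
  exact ⟨D, _, ι.trans e, fun b => (he _).trans (Renormed.norm_equiv b), hstar⟩
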